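/- Let $q$ be a prime power and let $k,l,m,h,n$ be integers with $0\le m\le l$, $1\le h\le k-1$ and $k=\frac{n-l-m}{2}\ge 2$. Assume $n\mid q-1$ and let $\lambda\in\mathbb F_q^*$ have multiplicative order dividing $\frac{q-1}{n}$. Let $\alpha_1,\dots,\alpha_n\in\mathbb F_q$ be the (pairwise distinct) roots of $x^n-\lambda$, let $v_i\in\{1,-1\}$ for $k\le i\le n$ and $v_i\in\mathbb F_q\setminus\{-1,0,1\}$ for $1\le i\le k-1$, and let $\eta_0,\dots,\eta_l\in\mathbb F_q$. Let $$\mathcal C_h=\Big\{\big(v_1f(\alpha_1),\dots,v_nf(\alpha_n)\big)\;:\;f(x)=\sum_{i=0}^{k-1}f_ix^i+f_h\sum_{t=0}^{l}\eta_tx^{k+t},\ f_0,\dots,f_{k-1}\in\mathbb F_q\Big\}\subseteq\mathbb F_q^n,$$ and let $r_{h-1}$ be the coefficient of $x^{h-1}$ in the remainder of $x^{h-1}+\sum_{t=0}^{l}\eta_tx^{k+t-1}$ on division by $\prod_{i=1}^{k-1}(x-\alpha_i)$. If $r_{h-1}\ne 0$ and $\sum_{t=m}^{l}\eta_t\eta_{l+m-t}=0$,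 then $\mathcal C_h$ is an LCD code, that is, $\mathcal C_h\cap\mathcal C_h^{\perp}=\{\mathbf 0\}$, where $\perp$ denotes the dual with respect to the Euclidean inner product $\langle x,y\rangle=\sum_i x_iy_i$. -/

import Mathlib

open Polynomial

/-- The `F`-space of twisted polynomials
`f(x) = ∑_{i=0}^{k-1} f_i x^i + f_h ∑_{t=0}^{l} η_t x^{k+t}`, with twist set `{0, …, l}` and
hook `h ∈ {0, …, k-1}`. Only the entries `η 0, …, η l` of `η` are used. -/
def twistedPolySpace {F : Type*} [Field F] (k l : ℕ) (h : Fin k) (η : ℕ → F) :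
    Submodule F F[X] where
  carrier := {p | ∃ f : Fin k → F,
    p = ∑ i : Fin k, C (f i) * X ^ (i : ℕ)
      + C (f h) * ∑ t ∈ Finset.range (l + 1), C (η t) * X ^ (k + t)}
  zero_mem' := ⟨0, by simp⟩
  add_mem' := by
    rintro _ _ ⟨f, rfl⟩ ⟨g, rfl⟩
    refine ⟨f + g, ?_⟩
    simp only [Pi.add_apply, C_add, add_mul, Finset.sum_add_distrib]
    ring
  smul_mem' := by
    rintro a _ ⟨f, rfl⟩
    refine ⟨a • f, ?_⟩
    simp only [Pi.smul_apply, smul_eq_mul, C_mul, smul_eq_C_mul, mul_add, Finset.mul_sum,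
      mul_assoc]

/-- The twisted generalized Reed-Solomon code `C_h`: all words
`(v_1 f(α_1), …, v_n f(α_n))` with `f` in the space of twisted polynomials. -/
def tgrsCode {F : Type*} [Field F] {n : ℕ} (k l : ℕ) (h : Fin k) (η : ℕ → F)
    (α v : Fin n → F) : Submodule F (Fin n → F) where
  carrier := {c | ∃ p ∈ twistedPolySpace k l h η, c = fun i => v i * p.eval (α i)}
  zero_mem' := ⟨0, Submodule.zero_mem _, by ext i; simp⟩
  add_mem' := by
    rintro _ _ ⟨p, hp, rfl⟩ ⟨q, hq, rfl⟩
    exact ⟨p + q, Submodule.add_mem _ hp hq, by ext i; simp [mul_add]⟩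
  smul_mem' := by
    rintro a _ ⟨p, hp, rfl⟩
    exact ⟨a • p, Submodule.smul_mem _ a hp, by ext i; simp [mul_left_comm]⟩

/-- The Euclidean dual `C^⊥` of a linear code `C ⊆ F^n`. -/
def euclideanDual {F : Type*} [Field F] {n : ℕ} (C : Submodule F (Fin n → F)) :
    Submodule F (Fin n → F) where
  carrier := {x | ∀ c ∈ C, ∑ i, x i * c i = 0}
  zero_mem' := by intro c _; simp
  add_mem' := by
    intro x y hx hy c hc
    simp [add_mul, Finset.sum_add_distrib, hx c hc, hy c hc]
  smul_mem' := by
    intro a x hx c hc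
    simp [mul_assoc, ← Finset.mul_sum, hx c hc]

/-- The Euclidean hull `C ∩ C^⊥`. -/
def hull {F : Type*} [Field F] {n : ℕ} (C : Submodule F (Fin n → F)) :
    Submodule F (Fin n → F) :=
  C ⊓ euclideanDual C

/-- A linear code is (Euclidean) LCD if its hull is zero. -/
def IsLCD {F : Type*} [Field F] {n : ℕ} (C : Submodule F (Fin n → F)) : Prop :=
  hull C = ⊥

/-- `q(x) = x^{h-1} + ∑_{t=0}^{l} η_t x^{k+t-1}` (used for `h ≥ 1`, `k ≥ 1`). -/
noncomputable def twistPoly {F : Type*} [Field F] (k l h : ℕ) (η : ℕ → F) : F[X] :=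
  X ^ (h - 1) + ∑ t ∈ Finset.range (l + 1), C (η t) * X ^ (k + t - 1)

/-- `g(x) = ∏_{i=1}^{k-1} (x - α_i)`; the point `α_i` is `α` at the index `i - 1 : Fin n`. -/
noncomputable def headPoly {F : Type*} [Field F] {n : ℕ} (k : ℕ) (α : Fin n → F) : F[X] :=
  ∏ i ∈ Finset.univ.filter (fun i : Fin n => (i : ℕ) + 1 ≤ k - 1), (X - C (α i))

/-! The roots of `x^n - λ` are permuted by multiplication by a primitive `n`-th root of unity, so
only the coefficients of `1` and `x^n` contribute to a sum of values over them. For twisted `p`, `q`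
the condition on `η` kills the `x^n` coefficient of `p q`, giving `∑ p q = n p₀ q₀`. If `p` yields a
hull word, then `∑ v_i² p q = 0`. Subtracting leaves only the `k - 1` head points, where `v_i² ≠ 1`.
There `r_{h-1} ≠ 0` lets a `q` with `q₀ = 0` take arbitrary values, so `p` vanishes at these points;
`q = 1` then gives `p₀ = 0`, and `r_{h-1} ≠ 0` again forces `p = 0`. -/

/-- The twist `∑_{t=0}^{l} η_t x^{k+t}`. -/
noncomputable def twistTail {F : Type*} [Field F] (k l : ℕ) (η : ℕ → F) : F[X] :=
  ∑ t ∈ Finset.range (l + 1), C (η t) * X ^ (k + t)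

theorem coeff_twistTail {F : Type*} [Field F] (k l : ℕ) (η : ℕ → F) (j : ℕ) :
    (twistTail k l η).coeff j = if k ≤ j ∧ j ≤ k + l then η (j - k) else 0 := by
  simp only [twistTail, finsetSum_coeff, coeff_C_mul, coeff_X_pow, mul_ite, mul_one, mul_zero]
  split_ifs with hj
  · rw [Finset.sum_eq_single (j - k)]
    · rw [if_pos (by omega)]
    · intro t _ ht
      rw [if_neg (by omega)]
    · intro ht
      exact absurd (Finset.mem_range.2 (by omega)) ht
  · refine Finset.sum_eq_zero fun t ht => if_neg ?_
    have := Finset.mem_range.1 ht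
    omega

theorem mem_twistedPolySpace_iff {F : Type*} [Field F] {k l : ℕ} {h : Fin k} {η : ℕ → F}
    {p : F[X]} :
    p ∈ twistedPolySpace k l h η ↔
      ∃ P : F[X], P.degree < k ∧ p = P + C (P.coeff h) * twistTail k l η := by
  constructor
  · rintro ⟨f, rfl⟩
    have hcoeff : (∑ i : Fin k, C (f i) * X ^ (i : ℕ)).coeff (h : ℕ) = f h := by
      simp [coeff_X_pow, Fin.val_inj]
    refine ⟨∑ i : Fin k, C (f i) * X ^ (i : ℕ), ?_, ?_⟩
    · exact degree_sum_fin_lt f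
    · rw [hcoeff, twistTail]
  · rintro ⟨P, hP, rfl⟩
    refine ⟨fun i => P.coeff i, ?_⟩
    have hlt : P.natDegree < k := by
      by_cases h0 : P = 0
      · subst h0; simpa using (lt_of_le_of_lt (Nat.zero_le _) h.2)
      · exact (natDegree_lt_iff_degree_lt h0).2 hP
    rw [Fin.sum_univ_eq_sum_range (fun i => C (P.coeff i) * X ^ i) k,
      ← as_sum_range_C_mul_X_pow' P hlt, twistTail]

theorem coeff_twisted {F : Type*} [Field F] {k l : ℕ} {η : ℕ → F} {P : F[X]}
    (hP : P.degree < k) (a : F) (j : ℕ) :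
    (P + C a * twistTail k l η).coeff j =
      if j < k then P.coeff j else if j ≤ k + l then a * η (j - k) else 0 := by
  rw [coeff_add, coeff_C_mul, coeff_twistTail]
  by_cases hj : j < k
  · rw [if_neg (by omega), if_pos hj]; simp
  · rw [if_neg hj, coeff_eq_zero_of_degree_lt (hP.trans_le (by exact_mod_cast not_lt.1 hj))]
    by_cases hj' : j ≤ k + l
    · rw [if_pos ⟨by omega, hj'⟩, if_pos hj', zero_add]
    · rw [if_neg (by omega), if_neg hj']; simp

/-- The coefficient of `x^n` in a product of two twisted polynomials vanishes under the
quadratic condition on the twist coefficients. -/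
theorem coeff_twisted_mul_eq_zero {F : Type*} [Field F] {n k l m : ℕ} {η : ℕ → F}
    (hn : n = 2 * k + l + m) (hη : ∑ t ∈ Finset.Icc m l, η t * η (l + m - t) = 0)
    {P Q : F[X]} (hP : P.degree < k) (hQ : Q.degree < k) (a b : F) :
    ((P + C a * twistTail k l η) * (Q + C b * twistTail k l η)).coeff n = 0 := by
  rw [coeff_mul, Finset.Nat.sum_antidiagonal_eq_sum_range_succ_mk]
  have hsub : (Finset.Icc m l).image (k + ·) ⊆ Finset.range (n + 1) := by
    intro j hj
    obtain ⟨t, ht, rfl⟩ := Finset.mem_image.1 hj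
    rw [Finset.mem_Icc] at ht
    exact Finset.mem_range.2 (by omega)
  rw [← Finset.sum_subset hsub, Finset.sum_image (fun x _ y _ hxy => by simpa using hxy)]
  · calc _ = ∑ t ∈ Finset.Icc m l, a * b * (η t * η (l + m - t)) := by
          refine Finset.sum_congr rfl fun t ht => ?_
          rw [Finset.mem_Icc] at ht
          simp only
          rw [coeff_twisted hP, coeff_twisted hQ, if_neg (by omega), if_pos (by omega),
            if_neg (by omega), if_pos (by omega)]
          rw [show k + t - k = t by omega, show n - (k + t) - k = l + m - t by omega]
          ring
      _ = 0 := by rw [← Finset.mul_sum, hη, mul_zero]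
  -- For the remaining `j`, either `j > k + l` or `n - j > k + l`, so one factor is beyond the
  -- degree bound.
  · intro j hj hj'
    have hj1 : ¬ (k + m ≤ j ∧ j ≤ k + l) := fun hc =>
      hj' (Finset.mem_image.2 ⟨j - k, Finset.mem_Icc.2 (by omega), by omega⟩)
    rw [Finset.mem_range] at hj
    simp only
    by_cases hjl : j ≤ k + l
    · rw [coeff_twisted hQ, if_neg (by omega), if_neg (by omega), mul_zero]
    · rw [coeff_twisted hP, if_neg (by omega), if_neg hjl, zero_mul]

/-! ### Power sums over the roots of `x^n - λ` -/

/-- Power sums over a finite family stable under multiplication by `ω` vanish in the exponents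
`j` with `ω ^ j ≠ 1`. -/
theorem sum_pow_eq_zero_of_mul_stable {F ι : Type*} [Field F] [Fintype ι] {α : ι → F}
    (hα : Function.Injective α) {ω : F} (hω : ω ≠ 0)
    (hst : ∀ i, ω * α i ∈ Set.range α) {j : ℕ} (hj : ω ^ j ≠ 1) :
    ∑ i, α i ^ j = 0 := by
  choose σ hσ using hst
  have hσi : Function.Injective σ := fun x y hxy => by
    have := hσ x
    rw [hxy, hσ y] at this
    exact (hα (mul_left_cancel₀ hω this)).symm
  have hsum : ∑ i, α i ^ j = ω ^ j * ∑ i, α i ^ j := by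
    conv_lhs => rw [← (Equiv.ofBijective σ (Finite.injective_iff_bijective.1 hσi)).sum_comp]
    simp [hσ, mul_pow, Finset.mul_sum]
  have : (ω ^ j - 1) * ∑ i, α i ^ j = 0 := by rw [sub_mul, ← hsum]; ring
  exact (mul_eq_zero.1 this).resolve_left (sub_ne_zero.2 hj)

theorem exists_isPrimitiveRoot_of_dvd_card_sub_one (F : Type*) [Field F] [Fintype F] {n : ℕ}
    (hnq : n ∣ Fintype.card F - 1) : ∃ ω : F, IsPrimitiveRoot ω n := by
  classical
  obtain ⟨g, hg⟩ := IsCyclic.exists_generator (α := Fˣ)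
  have hg' : orderOf g = Fintype.card F - 1 := by
    rw [orderOf_eq_card_of_forall_mem_zpowers hg, Nat.card_eq_fintype_card, Fintype.card_units]
  obtain ⟨d, hd⟩ := hnq
  have hpos : 0 < Fintype.card F - 1 := Nat.sub_pos_of_lt Fintype.one_lt_card
  have hprim := (IsPrimitiveRoot.orderOf g).pow (hg' ▸ hpos) (a := d) (b := n)
    (by rw [hg', hd, mul_comm])
  exact ⟨_, IsPrimitiveRoot.coe_units_iff.2 hprim⟩

/-- If `n = 0` in `F`, then `q - 1 = 0` there, whereas `q = 0` makes it `-1`. -/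
theorem natCast_ne_zero_of_dvd_card_sub_one (F : Type*) [Field F] [Fintype F] {n : ℕ}
    (hnq : n ∣ Fintype.card F - 1) : (n : F) ≠ 0 := by
  intro h0
  obtain ⟨d, hd⟩ := hnq
  have h1 : ((Fintype.card F - 1 : ℕ) : F) = 0 := by rw [hd, Nat.cast_mul, h0, zero_mul]
  rw [Nat.cast_sub Fintype.card_pos, Nat.cast_card_eq_zero] at h1
  simp at h1

/-- The sum of the values of a polynomial of degree `< 2n` at the `n` roots of `x^n - λ`. -/
theorem sum_eval_roots {F : Type*} [Field F] {n : ℕ} (hn0 : 0 < n) {ω : F}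
    (hω : IsPrimitiveRoot ω n) {lam : F} {α : Fin n → F} (hα : Function.Injective α)
    (hroots : ∀ x : F, (X ^ n - C lam).IsRoot x ↔ x ∈ Set.range α)
    {p : F[X]} (hp : p.natDegree < 2 * n) :
    ∑ i, p.eval (α i) = n * (p.coeff 0 + p.coeff n * lam) := by
  have hpow : ∀ i, α i ^ n = lam := fun i => by
    have := (hroots (α i)).2 ⟨i, rfl⟩
    simpa [IsRoot.def, sub_eq_zero] using this
  have hst : ∀ i, ω * α i ∈ Set.range α := fun i => by
    rw [← hroots, IsRoot.def]
    simp [mul_pow, hω.pow_eq_one, hpow i]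
  have hsum : ∀ j, ¬ n ∣ j → ∑ i, α i ^ j = 0 := fun j hj =>
    sum_pow_eq_zero_of_mul_stable hα (hω.ne_zero hn0.ne') hst
      fun h1 => hj ((hω.pow_eq_one_iff_dvd j).1 h1)
  simp only [eval_eq_sum_range' hp]
  rw [Finset.sum_comm]
  simp only [← Finset.mul_sum]
  have hsub : ({0, n} : Finset ℕ) ⊆ Finset.range (2 * n) := by
    intro j hj
    simp only [Finset.mem_insert, Finset.mem_singleton] at hj
    exact Finset.mem_range.2 (by omega)
  rw [← Finset.sum_subset hsub, Finset.sum_pair hn0.ne]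
  · simp [hpow]; ring
  · intro j hj hj'
    rw [hsum j, mul_zero]
    rintro ⟨c, rfl⟩
    have hc : c < 2 := by
      rw [Finset.mem_range, mul_comm 2] at hj
      exact Nat.lt_of_mul_lt_mul_left hj
    interval_cases c <;> simp at hj'

theorem sum_eval_twisted_mul {F : Type*} [Field F] {n k l m : ℕ} {η : ℕ → F}
    (hk : 0 < k) (hn : n = 2 * k + l + m) (hη : ∑ t ∈ Finset.Icc m l, η t * η (l + m - t) = 0)
    {ω : F} (hω : IsPrimitiveRoot ω n) {lam : F} {α : Fin n → F} (hα : Function.Injective α)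
    (hroots : ∀ x : F, (X ^ n - C lam).IsRoot x ↔ x ∈ Set.range α)
    {P Q : F[X]} (hP : P.degree < k) (hQ : Q.degree < k) (a b : F) :
    ∑ i, (P + C a * twistTail k l η).eval (α i) * (Q + C b * twistTail k l η).eval (α i) =
      n * (P.coeff 0 * Q.coeff 0) := by
  have hdeg : ∀ {R : F[X]}, R.degree < k → ∀ c : F,
      (R + C c * twistTail k l η).natDegree ≤ k + l := by
    intro R hR c
    refine natDegree_le_iff_coeff_eq_zero.2 fun j hj => ?_
    rw [coeff_twisted hR, if_neg (by omega), if_neg (by omega)]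
  simp only [← eval_mul]
  rw [sum_eval_roots (by omega) hω hα hroots, coeff_twisted_mul_eq_zero hn hη hP hQ,
    mul_coeff_zero, coeff_twisted hP, coeff_twisted hQ, if_pos hk, if_pos hk]
  · ring
  · refine natDegree_mul_le.trans_lt ?_
    have := hdeg hP a
    have := hdeg hQ b
    omega

/-! ### Interpolation at the head points -/

theorem X_mul_twistPoly {F : Type*} [Field F] {k l h : ℕ} (hk : 1 ≤ k) (hh : 1 ≤ h) (η : ℕ → F) :
    X * twistPoly k l h η = X ^ h + twistTail k l η := by
  rw [twistPoly, twistTail, mul_add, Finset.mul_sum, ← pow_succ', Nat.sub_add_cancel hh]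
  congr 1
  refine Finset.sum_congr rfl fun t _ => ?_
  rw [mul_left_comm, ← pow_succ', Nat.sub_add_cancel (by omega)]

theorem monic_headPoly {F : Type*} [Field F] {n : ℕ} (k : ℕ) (α : Fin n → F) :
    (headPoly k α).Monic :=
  monic_prod_of_monic _ _ fun i _ => monic_X_sub_C (α i)

theorem card_head {n k : ℕ} (hkn : k ≤ n) :
    (Finset.univ.filter (fun i : Fin n => (i : ℕ) + 1 ≤ k - 1)).card = k - 1 := by
  have h1 : Finset.univ.filter (fun i : Fin n => (i : ℕ) + 1 ≤ k - 1) =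
      Finset.univ.filter (fun i : Fin n => (i : ℕ) < k - 1) := rfl
  rw [h1, Fin.card_filter_val_lt]
  omega

theorem degree_headPoly {F : Type*} [Field F] {n k : ℕ} (hkn : k ≤ n) (α : Fin n → F) :
    (headPoly k α).degree = ((k - 1 : ℕ) : WithBot ℕ) := by
  rw [headPoly, degree_prod, Finset.sum_congr rfl fun i _ => degree_X_sub_C (α i),
    Finset.sum_const, card_head hkn]
  simp

theorem eval_mod_headPoly {F : Type*} [Field F] {n k : ℕ} {α : Fin n → F} {i : Fin n}
    (hi : (i : ℕ) + 1 ≤ k - 1) (p : F[X]) :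
    (p % headPoly k α).eval (α i) = p.eval (α i) := by
  have h0 : (headPoly k α).eval (α i) = 0 := by
    rw [headPoly, eval_prod]
    exact Finset.prod_eq_zero (Finset.mem_filter.2 ⟨Finset.mem_univ i, hi⟩) (by simp)
  conv_rhs => rw [← EuclideanDomain.mod_add_div p (headPoly k α)]
  simp [h0]

theorem degree_X_mul_lt {F : Type*} [Field F] {k : ℕ} (hk : 1 ≤ k) {w : F[X]}
    (hw : w.degree < ((k - 1 : ℕ) : WithBot ℕ)) : (X * w).degree < (k : WithBot ℕ) := by
  rw [degree_lt_iff_coeff_zero] at hw ⊢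
  intro j hj
  obtain ⟨j, rfl⟩ : ∃ i, j = i + 1 := ⟨j - 1, by omega⟩
  rw [coeff_X_mul, hw j (by omega)]

/-- Any values of `u` at the head points are attained by `x⁻¹ p` for a twisted polynomial `p`
without constant term. -/
theorem exists_twisted_eval_eq {F : Type*} [Field F] {n k l h : ℕ} {η : ℕ → F} {α : Fin n → F}
    (hkn : k ≤ n) (hh : 1 ≤ h) (hhk : h < k)
    (hr : (twistPoly k l h η % headPoly k α).coeff (h - 1) ≠ 0)
    {u : F[X]} (hu : u.degree < ((k - 1 : ℕ) : WithBot ℕ)) :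
    ∃ Q : F[X], Q.degree < k ∧ Q.coeff 0 = 0 ∧ ∀ i : Fin n, (i : ℕ) + 1 ≤ k - 1 →
      (Q + C (Q.coeff h) * twistTail k l η).eval (α i) = α i * u.eval (α i) := by
  set r := twistPoly k l h η % headPoly k α with hr_def
  have hrdeg : r.degree < ((k - 1 : ℕ) : WithBot ℕ) := by
    rw [← degree_headPoly hkn α]
    exact degree_mod_lt _ (monic_headPoly k α).ne_zero
  -- This `c` solves `u_{h-1} - c r_{h-1} + c = c`, so the hook coefficient of the witness is again
  -- `c`.
  set c := u.coeff (h - 1) / r.coeff (h - 1) with hc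
  have hcoeff : (X * (u - C c * r + C c * X ^ (h - 1))).coeff h = c := by
    obtain ⟨j, rfl⟩ : ∃ j, h = j + 1 := ⟨h - 1, by omega⟩
    rw [Nat.add_sub_cancel] at *
    rw [coeff_X_mul]
    simp only [coeff_add, coeff_sub, coeff_C_mul, coeff_X_pow_self]
    rw [hc, div_mul_cancel₀ _ hr]
    ring
  refine ⟨X * (u - C c * r + C c * X ^ (h - 1)), degree_X_mul_lt (by omega) ?_, by simp, ?_⟩
  · rw [degree_lt_iff_coeff_zero] at hu hrdeg ⊢
    intro j hj
    rw [coeff_add, coeff_sub, coeff_C_mul, coeff_C_mul, hu j hj, hrdeg j hj, coeff_X_pow,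
      if_neg (by omega)]
    ring
  · intro i hi
    rw [hcoeff]
    have h1 : X * (u - C c * r + C c * X ^ (h - 1)) + C c * twistTail k l η =
        X * (u - C c * r + C c * twistPoly k l h η) := by
      have h2 := X_mul_twistPoly (l := l) (show 1 ≤ k by omega) hh η
      have h3 : (X : F[X]) * X ^ (h - 1) = X ^ h := by
        rw [← pow_succ', Nat.sub_add_cancel hh]
      linear_combination (-C c) * h2 + C c * h3
    rw [h1]
    simp [hr_def, eval_mod_headPoly hi]

/-- A twisted polynomial without constant term that vanishes at the head points is zero. -/
theorem twisted_eq_zero {F : Type*} [Field F] {n k l h : ℕ} {η : ℕ → F} {α : Fin n → F}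
    (hα : Function.Injective α) (hα0 : ∀ i, α i ≠ 0)
    (hkn : k ≤ n) (hh : 1 ≤ h) (hhk : h < k)
    (hr : (twistPoly k l h η % headPoly k α).coeff (h - 1) ≠ 0)
    {P : F[X]} (hP : P.degree < k) (hP0 : P.coeff 0 = 0)
    (hev : ∀ i : Fin n, (i : ℕ) + 1 ≤ k - 1 →
      (P + C (P.coeff h) * twistTail k l η).eval (α i) = 0) : P = 0 := by
  set r := twistPoly k l h η % headPoly k α with hr_def
  have hrdeg : r.degree < ((k - 1 : ℕ) : WithBot ℕ) := by
    rw [← degree_headPoly hkn α]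
    exact degree_mod_lt _ (monic_headPoly k α).ne_zero
  obtain ⟨w, rfl⟩ := X_dvd_iff.2 hP0
  obtain ⟨j, rfl⟩ : ∃ j, h = j + 1 := ⟨h - 1, by omega⟩
  rw [Nat.add_sub_cancel] at hr
  rw [coeff_X_mul] at hev
  have hwdeg : w.degree < ((k - 1 : ℕ) : WithBot ℕ) := by
    rw [degree_lt_iff_coeff_zero] at hP ⊢
    intro i hi
    rw [← coeff_X_mul, hP (i + 1) (by omega)]
  -- This is `p / x` reduced modulo `headPoly`: degree below `k - 1`, with `k - 1` zeros.
  have hzero : w - C (w.coeff j) * X ^ j + C (w.coeff j) * r = 0 := by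
    refine eq_zero_of_degree_lt_of_eval_index_eq_zero
      (Finset.univ.filter (fun i : Fin n => (i : ℕ) + 1 ≤ k - 1)) hα.injOn ?_ ?_
    · rw [card_head hkn]
      rw [degree_lt_iff_coeff_zero] at hwdeg hrdeg ⊢
      intro i hi
      rw [coeff_add, coeff_sub, coeff_C_mul, coeff_C_mul, hwdeg i hi, hrdeg i hi, coeff_X_pow,
        if_neg (by omega)]
      ring
    · intro i hi
      have hi' := (Finset.mem_filter.1 hi).2
      have h1 : X * w + C (w.coeff j) * twistTail k l η =
          X * (w - C (w.coeff j) * X ^ j + C (w.coeff j) * twistPoly k l (j + 1) η) := by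
        have h2 := X_mul_twistPoly (l := l) (show 1 ≤ k by omega) hh η
        linear_combination (-C (w.coeff j)) * h2
      have h3 := hev i hi'
      rw [h1, eval_mul, eval_X] at h3
      have h4 := (mul_eq_zero.1 h3).resolve_left (hα0 i)
      simpa [hr_def, eval_mod_headPoly hi'] using h4
  -- The `x^j` coefficient of `hzero` is `w_j r_j`.
  have hwj : w.coeff j = 0 := by
    have := congrArg (fun p : F[X] => p.coeff j) hzero
    simpa [hr] using this
  simpa [hwj] using hzero

/-! ### The hull is trivial -/

theorem mainTheorem2 {F : Type*} [Field F] [Fintype F]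
    (n k l m : ℕ) (h : Fin k)
    (hk : 2 ≤ k) (hml : m ≤ l) (hn : n = 2 * k + l + m)
    (hh : 1 ≤ (h : ℕ))
    (hnq : n ∣ Fintype.card F - 1)
    (lam : Fˣ) (hlam : orderOf lam ∣ (Fintype.card F - 1) / n)
    (η : ℕ → F) (α v : Fin n → F)
    (hα : Function.Injective α)
    (hroots : ∀ x : F, (X ^ n - C (lam : F)).IsRoot x ↔ x ∈ Set.range α)
    (hv_tail : ∀ i : Fin n, k ≤ (i : ℕ) + 1 → v i = 1 ∨ v i = -1)
    (hv_head : ∀ i : Fin n, (i : ℕ) + 1 ≤ k - 1 → v i ≠ -1 ∧ v i ≠ 0 ∧ v i ≠ 1)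
    (hr : (twistPoly k l h η % headPoly k α).coeff ((h : ℕ) - 1) ≠ 0)
    (hη : ∑ t ∈ Finset.Icc m l, η t * η (l + m - t) = 0) :
    IsLCD (tgrsCode k l h η α v) := by
  obtain ⟨ω, hω⟩ := exists_isPrimitiveRoot_of_dvd_card_sub_one F hnq
  have hnF := natCast_ne_zero_of_dvd_card_sub_one F hnq
  have hkn : k ≤ n := by omega
  have hα0 : ∀ i, α i ≠ 0 := fun i h0 => by
    have := (hroots (α i)).2 ⟨i, rfl⟩
    simp [IsRoot.def, h0, show n ≠ 0 by omega] at this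
  have hv1 : ∀ i : Fin n, (i : ℕ) + 1 ≤ k - 1 → v i ^ 2 - 1 ≠ 0 := fun i hi h0 => by
    rcases sq_eq_sq_iff_eq_or_eq_neg.1 ((sub_eq_zero.1 h0).trans (one_pow 2).symm) with h1 | h1
    · exact (hv_head i hi).2.2 h1
    · exact (hv_head i hi).1 h1
  have hv0 : ∀ i : Fin n, ¬ (i : ℕ) + 1 ≤ k - 1 → v i ^ 2 - 1 = 0 := fun i hi => by
    rcases hv_tail i (by omega) with h1 | h1 <;> simp [h1]
  rw [IsLCD, hull, eq_bot_iff]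
  rintro _ ⟨⟨p, hp, rfl⟩, hdual⟩
  obtain ⟨P, hP, rfl⟩ := mem_twistedPolySpace_iff.1 hp
  set p := P + C (P.coeff h) * twistTail k l η with hp_def
  have key : ∀ Q : F[X], Q.degree < k →
      ∑ i, (v i ^ 2 - 1) * (p.eval (α i) *
        (Q + C (Q.coeff h) * twistTail k l η).eval (α i)) = -(n * (P.coeff 0 * Q.coeff 0)) := by
    intro Q hQ
    have h1 := hdual _ ⟨_, mem_twistedPolySpace_iff.2 ⟨Q, hQ, rfl⟩, rfl⟩
    rw [← sum_eval_twisted_mul (by omega) hn hη hω hα hroots hP hQ (P.coeff h) (Q.coeff h),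
      ← sub_eq_zero, sub_neg_eq_add, ← Finset.sum_add_distrib, ← h1]
    exact Finset.sum_congr rfl fun i _ => by ring
  have hhead : ∀ i : Fin n, (i : ℕ) + 1 ≤ k - 1 → p.eval (α i) = 0 := by
    intro i hi
    set s := (Finset.univ.filter (fun i : Fin n => (i : ℕ) + 1 ≤ k - 1)) with hs
    have his : i ∈ s := Finset.mem_filter.2 ⟨Finset.mem_univ i, hi⟩
    have hu := Lagrange.degree_basis hα.injOn his
    -- A Lagrange basis polynomial isolates the single term at `α i`.
    obtain ⟨Q, hQ, hQ0, hQev⟩ := exists_twisted_eval_eq (l := l) (η := η) hkn hh h.2 hr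
      (u := Lagrange.basis s α i) (by
        rw [hu, card_head hkn, Nat.cast_lt]; omega)
    have h1 := key Q hQ
    rw [hQ0, mul_zero, mul_zero, neg_zero, Finset.sum_eq_single i] at h1
    · rw [hQev i hi, Lagrange.eval_basis_self hα.injOn his] at h1
      simpa [hv1 i hi, hα0 i] using h1
    · intro j _ hji
      by_cases hj : (j : ℕ) + 1 ≤ k - 1
      · rw [hQev j hj, Lagrange.eval_basis_of_ne hji.symm
          (Finset.mem_filter.2 ⟨Finset.mem_univ j, hj⟩)]
        ring
      · rw [hv0 j hj, zero_mul]
    · exact fun hi' => absurd (Finset.mem_univ i) hi'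
  have hP0 : P.coeff 0 = 0 := by
    -- Since `h ≥ 1`, the constant `1` has hook coefficient zero and so carries no twist.
    have h1 := key 1 (by rw [degree_one]; exact_mod_cast (show 0 < k by omega))
    rw [Finset.sum_eq_zero] at h1
    · simpa [hnF] using h1
    · intro i _
      by_cases hi : (i : ℕ) + 1 ≤ k - 1
      · rw [hhead i hi]; ring
      · rw [hv0 i hi, zero_mul]
  have hPz := twisted_eq_zero hα hα0 hkn hh h.2 hr hP hP0 hhead
  rw [Submodule.mem_bot]
  ext i
  simp [hp_def, hPz]
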